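/- Let $k$ be an algebraically closed field, let $n$ be a positive integer, and let $q=(q_{ij})$ be an $n\times n$ matrix with entries in $k^\times$ such that $q_{ii}=1$ and $q_{ij}=q_{ji}^{-1}$ for all $i,j$; assume that all $q_{ij}$ are roots of unity. Let $L=k_q[[x_1^{\pm1},\ldots,x_n^{\pm1}]]$ be the $q$-commutative Laurent series ring: its elements are the formal series $\sum_{s\in\mathbb Z^n}c_sx^s$ with $c_s\in k$, $x^s=x_1^{s_1}\cdots x_n^{s_n}$, and $c_s=0$ for $\min\{s_1,\ldots,s_n\}\ll 0$, and its multiplication is determined by the relations $x_ix_j=q_{ij}x_jx_i$. (Equivalently, $L$ is the localization of the $q$-commutative power series ring $k_q[[x_1,\ldots,x_n]]$ at the multiplicative set generated by $x_1,\ldots,x_n$.) Put $$\sigma(s,t)=\prod_{i,j=1}^n q_{ij}^{s_it_j}\quad(s,t\in\mathbb Z^n),\qquad S=\{s\in\mathbb Z^n : \sigma(s,t)=1\text{ for all }t\in\mathbb Z^n\}.$$ **Proposition 4.1.** Suppose that the group $S$ has a positive diagonal basis, that is, a $\mathbb Z$-basis $\mathbf b_1,\ldots,\mathbf b_n$ such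 that the $n\times n$ matrix with $i$th row $\mathbf b_i$ is diagonal with all diagonal entries positive. Then $L$ is a unique factorization ring in the sense of Chatters and Jordan: $L$ is a (left and right) noetherian prime ring in which every height-one prime ideal $P$ is principal, i.e. $P=aL=La$ for some $a\in L$. -/

import Mathlib

/-- The cocycle of the ordered monomials `x^s = x_1^{s_1} ⋯ x_n^{s_n}`: the relations
`x_i x_j = q_{ij} x_j x_i` give `x^s x^t = c(s,t) x^{s+t}` with
`c(s,t) = ∏_{j < i} q_{ij}^{s_i t_j}`. -/
def qCocycle {k : Type*} [Field k] {n : ℕ} (q : Fin n → Fin n → kˣ) (s t : Fin n → ℤ) : kˣ :=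
  ∏ i, ∏ j, if j < i then q i j ^ (s i * t j) else 1

/-- The `q`-commutative Laurent series ring `L = k_q[[x_1^{±1}, …, x_n^{±1}]]`. Its elements are the
formal series `∑ c_s x^s`, `s ∈ ℤⁿ`, with `c_s = 0` for `min {s_1, …, s_n} ≪ 0`; an element is
given by its coefficients with respect to the ordered monomials `x^s = x_1^{s_1} ⋯ x_n^{s_n}`. -/
@[ext]
structure QLaurent {k : Type*} [Field k] {n : ℕ} (q : Fin n → Fin n → kˣ) where
  coeff : (Fin n → ℤ) → k
  bounded : ∃ N : ℤ, ∀ s, (∃ i, s i < N) → coeff s = 0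

namespace QLaurent

variable {k : Type*} [Field k] {n : ℕ} {q : Fin n → Fin n → kˣ}

theorem qCocycle_add_left (s s' t : Fin n → ℤ) :
    qCocycle q (s + s') t = qCocycle q s t * qCocycle q s' t := by
  simp only [qCocycle, ← Finset.prod_mul_distrib]
  refine Finset.prod_congr rfl fun i _ => Finset.prod_congr rfl fun j _ => ?_
  split_ifs <;> simp [add_mul, zpow_add]

theorem qCocycle_add_right (s t t' : Fin n → ℤ) :
    qCocycle q s (t + t') = qCocycle q s t * qCocycle q s t' := by
  simp only [qCocycle, ← Finset.prod_mul_distrib]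
  refine Finset.prod_congr rfl fun i _ => Finset.prod_congr rfl fun j _ => ?_
  split_ifs <;> simp [mul_add, zpow_add]

theorem qCocycle_zero_left (t : Fin n → ℤ) : qCocycle q 0 t = 1 := by
  simp [qCocycle]

theorem qCocycle_zero_right (s : Fin n → ℤ) : qCocycle q s 0 = 1 := by
  simp [qCocycle]

theorem le_of_coeff_ne_zero {f : (Fin n → ℤ) → k} {N : ℤ}
    (h : ∀ s, (∃ i, s i < N) → f s = 0) {s : Fin n → ℤ} (hs : f s ≠ 0) (i : Fin n) : N ≤ s i := by
  by_contra hlt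
  exact hs (h s ⟨i, not_le.mp hlt⟩)

/-- The terms of the product. -/
def mulTerm (f g : QLaurent q) (u s : Fin n → ℤ) : k :=
  (qCocycle q s (u - s) : k) * (f.coeff s * g.coeff (u - s))

theorem mulTerm_finite (f g : QLaurent q) (u : Fin n → ℤ) :
    Function.HasFiniteSupport (mulTerm f g u) := by
  obtain ⟨N, hN⟩ := f.bounded
  obtain ⟨M, hM⟩ := g.bounded
  refine (Set.finite_Icc (fun _ => N) (fun i => u i - M)).subset fun s hs => ?_
  have h1 : f.coeff s ≠ 0 := fun h => hs (by simp [mulTerm, h])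
  have h2 : g.coeff (u - s) ≠ 0 := fun h => hs (by simp [mulTerm, h])
  refine ⟨fun i => le_of_coeff_ne_zero hN h1 i, fun i => ?_⟩
  have := le_of_coeff_ne_zero hM h2 i
  simp only [Pi.sub_apply] at this
  show s i ≤ u i - M
  linarith

instance : Zero (QLaurent q) := ⟨⟨0, 0, fun _ _ => rfl⟩⟩

/-- The constant series `1 = x^0`. -/
instance : One (QLaurent q) :=
  ⟨⟨Pi.single 0 1, 0, fun s ⟨i, hi⟩ =>
    Pi.single_eq_of_ne (fun h => by simp [h] at hi) _⟩⟩

instance : Add (QLaurent q) :=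
  ⟨fun f g => ⟨f.coeff + g.coeff, by
    obtain ⟨N, hN⟩ := f.bounded
    obtain ⟨M, hM⟩ := g.bounded
    refine ⟨min N M, fun s ⟨i, hi⟩ => ?_⟩
    simp [hN s ⟨i, hi.trans_le (min_le_left _ _)⟩, hM s ⟨i, hi.trans_le (min_le_right _ _)⟩]⟩⟩

instance : Neg (QLaurent q) :=
  ⟨fun f => ⟨-f.coeff, by
    obtain ⟨N, hN⟩ := f.bounded
    exact ⟨N, fun s hs => by simp [hN s hs]⟩⟩⟩

/-- `(∑ a_s x^s) (∑ b_t x^t) = ∑_u (∑_{s + t = u} c(s,t) a_s b_t) x^u`; the inner sums have only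
finitely many nonzero terms. -/
noncomputable instance : Mul (QLaurent q) :=
  ⟨fun f g => ⟨fun u => ∑ᶠ s, mulTerm f g u s, by
    obtain ⟨N, hN⟩ := f.bounded
    obtain ⟨M, hM⟩ := g.bounded
    refine ⟨N + M, fun u ⟨i, hi⟩ => finsum_eq_zero_of_forall_eq_zero fun s => ?_⟩
    by_cases h : s i < N
    · simp [mulTerm, hN s ⟨i, h⟩]
    · have : g.coeff (u - s) = 0 := hM _ ⟨i, by simp only [Pi.sub_apply]; linarith⟩
      simp [mulTerm, this]⟩⟩

theorem coeff_zero : (0 : QLaurent q).coeff = 0 := rfl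
theorem coeff_one : (1 : QLaurent q).coeff = Pi.single 0 1 := rfl
theorem coeff_add (f g : QLaurent q) : (f + g).coeff = f.coeff + g.coeff := rfl
theorem coeff_neg (f : QLaurent q) : (-f).coeff = -f.coeff := rfl
theorem coeff_mul (f g : QLaurent q) (u : Fin n → ℤ) :
    (f * g).coeff u =
      ∑ᶠ s, (qCocycle q s (u - s) : k) * (f.coeff s * g.coeff (u - s)) := rfl

protected theorem one_mul (f : QLaurent q) : 1 * f = f := by
  ext u
  rw [coeff_mul, finsum_eq_single _ 0]
  · simp [coeff_one, qCocycle_zero_left]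
  · intro s hs
    simp [coeff_one, Pi.single_eq_of_ne hs]

protected theorem mul_one (f : QLaurent q) : f * 1 = f := by
  ext u
  rw [coeff_mul, finsum_eq_single _ u]
  · simp [coeff_one, qCocycle_zero_right]
  · intro s hs
    simp [coeff_one, Pi.single_eq_of_ne (sub_ne_zero.mpr hs.symm)]

protected theorem left_distrib (f g h : QLaurent q) : f * (g + h) = f * g + f * h := by
  ext u
  refine Eq.trans (finsum_congr fun s => ?_)
    (finsum_add_distrib (mulTerm_finite f g u) (mulTerm_finite f h u))
  simp only [mulTerm, coeff_add, Pi.add_apply]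
  ring

protected theorem right_distrib (f g h : QLaurent q) : (f + g) * h = f * h + g * h := by
  ext u
  refine Eq.trans (finsum_congr fun s => ?_)
    (finsum_add_distrib (mulTerm_finite f h u) (mulTerm_finite g h u))
  simp only [mulTerm, coeff_add, Pi.add_apply]
  ring

theorem assocTerm_finite (f g h : QLaurent q) (u : Fin n → ℤ)
    (c : (Fin n → ℤ) × (Fin n → ℤ) → k) :
    Function.HasFiniteSupport fun p : (Fin n → ℤ) × (Fin n → ℤ) =>
      c p * (f.coeff p.1 * g.coeff p.2 * h.coeff (u - p.1 - p.2)) := by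
  obtain ⟨N, hN⟩ := f.bounded
  obtain ⟨M, hM⟩ := g.bounded
  obtain ⟨K, hK⟩ := h.bounded
  refine ((Set.finite_Icc (fun _ => N) (fun i => u i - M - K)).prod
    (Set.finite_Icc (fun _ => M) (fun i => u i - N - K))).subset fun p hp => ?_
  have h1 : f.coeff p.1 ≠ 0 := fun e => hp (by simp [e])
  have h2 : g.coeff p.2 ≠ 0 := fun e => hp (by simp [e])
  have h3 : h.coeff (u - p.1 - p.2) ≠ 0 := fun e => hp (by simp [e])
  have key : ∀ i, N ≤ p.1 i ∧ M ≤ p.2 i ∧ K ≤ u i - p.1 i - p.2 i := fun i =>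
    ⟨le_of_coeff_ne_zero hN h1 i, le_of_coeff_ne_zero hM h2 i, le_of_coeff_ne_zero hK h3 i⟩
  refine ⟨⟨fun i => (key i).1, fun i => ?_⟩, ⟨fun i => (key i).2.1, fun i => ?_⟩⟩
  · show p.1 i ≤ u i - M - K
    linarith [(key i).2.1, (key i).2.2]
  · show p.2 i ≤ u i - N - K
    linarith [(key i).1, (key i).2.2]

protected theorem mul_assoc (f g h : QLaurent q) : f * g * h = f * (g * h) := by
  ext u
  set F : (Fin n → ℤ) × (Fin n → ℤ) → k := fun p =>
    ((qCocycle q p.1 p.2 * qCocycle q p.1 (u - p.1 - p.2) * qCocycle q p.2 (u - p.1 - p.2) : kˣ) : k)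
      * (f.coeff p.1 * g.coeff p.2 * h.coeff (u - p.1 - p.2)) with hF
  have hfin : Function.HasFiniteSupport F := assocTerm_finite f g h u _
  have hR : (f * (g * h)).coeff u = ∑ᶠ p, F p := by
    rw [finsum_curry _ hfin, coeff_mul]
    refine finsum_congr fun s => ?_
    rw [coeff_mul, ← mul_assoc, mul_finsum]
    refine finsum_congr fun t => ?_
    have : qCocycle q s (u - s) = qCocycle q s t * qCocycle q s (u - s - t) := by
      rw [← qCocycle_add_right]; congr 1; abel
    rw [this, hF]
    push_cast
    ring
  let e : (Fin n → ℤ) × (Fin n → ℤ) ≃ (Fin n → ℤ) × (Fin n → ℤ) :=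
    { toFun := fun p => (p.2, p.1 - p.2)
      invFun := fun p => (p.1 + p.2, p.1)
      left_inv := fun p => by simp
      right_inv := fun p => by simp }
  have hL : (f * g * h).coeff u = ∑ᶠ p, F (e p) := by
    refine Eq.trans ?_ (finsum_curry (F ∘ e) (hfin.comp_of_injective e.injective)).symm
    rw [coeff_mul]
    refine finsum_congr fun t => ?_
    rw [coeff_mul, finsum_mul, mul_finsum]
    refine finsum_congr fun s => ?_
    have : qCocycle q t (u - t) = qCocycle q s (u - t) * qCocycle q (t - s) (u - t) := by
      rw [← qCocycle_add_left]; congr 1; abel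
    have h2 : u - s - (t - s) = u - t := by abel
    simp only [this, hF, e, Function.comp_apply, Equiv.coe_fn_mk, h2]
    push_cast
    ring
  rw [hL, hR, finsum_comp_equiv]

noncomputable instance : Ring (QLaurent q) where
  add_assoc f g h := by ext; simp [coeff_add, add_assoc]
  zero_add f := by ext; simp [coeff_add, coeff_zero]
  add_zero f := by ext; simp [coeff_add, coeff_zero]
  add_comm f g := by ext; simp [coeff_add, add_comm]
  neg_add_cancel f := by ext; simp [coeff_add, coeff_neg, coeff_zero]
  nsmul := nsmulRec
  zsmul := zsmulRec
  left_distrib := QLaurent.left_distrib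
  right_distrib := QLaurent.right_distrib
  zero_mul f := by ext; simp [coeff_mul, coeff_zero]
  mul_zero f := by ext; simp [coeff_mul, coeff_zero]
  mul_assoc := QLaurent.mul_assoc
  one_mul := QLaurent.one_mul
  mul_one := QLaurent.mul_one

/-- The monomial `x^s`. -/
def monomial (q : Fin n → Fin n → kˣ) (s : Fin n → ℤ) : QLaurent q :=
  ⟨Pi.single s 1, by
    obtain ⟨N, hN⟩ := (Set.finite_range s).bddBelow
    refine ⟨N, fun t ⟨i, hi⟩ => Pi.single_eq_of_ne ?_ _⟩
    rintro rfl
    exact absurd (hN ⟨i, rfl⟩) (not_le.mpr hi)⟩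

/-- The indeterminate `x_i`. -/
def X (q : Fin n → Fin n → kˣ) (i : Fin n) : QLaurent q := monomial q (Pi.single i 1)

/-- The elements of the `q`-commutative power series ring `R = k_q[[x_1, …, x_n]]` inside `L`. -/
def IsPowerSeries (f : QLaurent q) : Prop := ∀ s, (∃ i, s i < 0) → f.coeff s = 0

theorem coeff_monomial_mul (s : Fin n → ℤ) (f : QLaurent q) (u : Fin n → ℤ) :
    (monomial q s * f).coeff u = (qCocycle q s (u - s) : k) * f.coeff (u - s) := by
  rw [coeff_mul, finsum_eq_single _ s]
  · simp [monomial]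
  · intro t ht
    simp [monomial, Pi.single_eq_of_ne ht]

theorem coeff_monomial_mul_monomial (s t u : Fin n → ℤ) :
    (monomial q s * monomial q t).coeff u = (qCocycle q s t : k) * (monomial q (s + t)).coeff u := by
  rw [coeff_monomial_mul]
  by_cases h : u = s + t
  · subst h
    simp [monomial]
  · have h' : u - s ≠ t := fun e => h (by rw [← e]; abel)
    simp [monomial, Pi.single_eq_of_ne h, Pi.single_eq_of_ne h']

/-- The defining relations `x_i x_j = q_{ij} x_j x_i`. -/
theorem coeff_X_mul_X (h1 : ∀ i, q i i = 1) (h2 : ∀ i j, q i j = (q j i)⁻¹) (i j : Fin n)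
    (u : Fin n → ℤ) : (X q i * X q j).coeff u = (q i j : k) * (X q j * X q i).coeff u := by
  have key : ∀ a b : Fin n, qCocycle q (Pi.single a 1) (Pi.single b 1) =
      if b < a then q a b else 1 := by
    intro a b
    rw [qCocycle, Finset.prod_eq_single a, Finset.prod_eq_single b]
    · simp
    · intro c _ hc; simp [Pi.single_eq_of_ne hc]
    · simp
    · intro c _ hc; simp [Pi.single_eq_of_ne hc]
    · simp
  simp only [X, coeff_monomial_mul_monomial, key,
    add_comm (Pi.single j 1 : Fin n → ℤ) (Pi.single i 1)]
  rcases lt_trichotomy i j with h | rfl | h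
  · simp [h, h.not_gt, h2 i j]
  · simp [h1]
  · simp [h, h.not_gt]

/-- Every element of `L` is a left fraction with a power series as its numerator and a monomial in
`x_1, …, x_n` as its denominator. -/
theorem exists_monomial_mul_isPowerSeries (f : QLaurent q) :
    ∃ m : Fin n → ℤ, (∀ i, 0 ≤ m i) ∧ IsPowerSeries (monomial q m * f) := by
  obtain ⟨N, hN⟩ := f.bounded
  refine ⟨fun _ => max (-N) 0, fun i => le_max_right _ _, fun s ⟨i, hi⟩ => ?_⟩
  rw [coeff_monomial_mul, hN _ ⟨i, ?_⟩, mul_zero]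
  simp only [Pi.sub_apply]
  linarith [le_max_left (-N) 0]

theorem isUnit_X (i : Fin n) : IsUnit (X q i) := by
  have hm : ∀ s t : Fin n → ℤ, s + t = 0 → ∃ a b : QLaurent q,
      monomial q s * monomial q t * a = 1 ∧ b * (monomial q s * monomial q t) = 1 := by
    intro s t h
    have hc : monomial q s * monomial q t = ⟨Pi.single 0 (qCocycle q s t : k), 0, fun v ⟨i, hi⟩ =>
        Pi.single_eq_of_ne (fun e => by simp [e] at hi) _⟩ := by
      ext u
      rw [coeff_monomial_mul_monomial, h]
      by_cases hu : u = 0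
      · subst hu; simp [monomial]
      · simp [monomial, Pi.single_eq_of_ne hu]
    let d : QLaurent q := ⟨Pi.single 0 ((qCocycle q s t)⁻¹ : kˣ), 0, fun v ⟨i, hi⟩ =>
        Pi.single_eq_of_ne (fun e => by simp [e] at hi) _⟩
    refine ⟨d, d, ?_, ?_⟩
    all_goals
      rw [hc]
      ext u
      rw [coeff_mul, finsum_eq_single _ 0 (fun v hv => by simp [d, Pi.single_eq_of_ne hv]), coeff_one]
      by_cases hu : u = 0
      · subst hu; simp [d, qCocycle_zero_left]
      · simp [d, Pi.single_eq_of_ne hu]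
  obtain ⟨a, _, ha, _⟩ := hm (Pi.single i 1) (-Pi.single i 1) (by simp)
  obtain ⟨_, b, _, hb⟩ := hm (-Pi.single i 1) (Pi.single i 1) (by simp)
  rw [mul_assoc] at ha
  rw [← mul_assoc] at hb
  exact isUnit_iff_exists_and_exists.mpr ⟨⟨_, ha⟩, ⟨_, hb⟩⟩

end QLaurent

/-- The alternating bicharacter `σ(s,t) = ∏_{i,j} q_{ij}^{s_i t_j}` on `ℤⁿ`. -/
def qSigma {k : Type*} [Field k] {n : ℕ} (q : Fin n → Fin n → kˣ) (s t : Fin n → ℤ) : kˣ :=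
  ∏ i, ∏ j, q i j ^ (s i * t j)

/-- The subgroup `S = {s ∈ ℤⁿ | σ(s,t) = 1 for all t ∈ ℤⁿ}`. -/
def qRadical {k : Type*} [Field k] {n : ℕ} (q : Fin n → Fin n → kˣ) :
    AddSubgroup (Fin n → ℤ) where
  carrier := {s | ∀ t, qSigma q s t = 1}
  zero_mem' t := by simp [qSigma]
  add_mem' {a b} ha hb t := by
    have h : qSigma q (a + b) t = qSigma q a t * qSigma q b t := by
      simp [qSigma, add_mul, zpow_add, Finset.prod_mul_distrib]
    rw [h, ha t, hb t, one_mul]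
  neg_mem' {a} ha t := by
    have h : qSigma q (-a) t = (qSigma q a t)⁻¹ := by
      simp [qSigma, zpow_neg]
    rw [h, ha t, inv_one]

/-- A subgroup of `ℤⁿ` has a positive diagonal basis if it has a `ℤ`-basis `b_1, …, b_n` such that
the matrix with rows `b_1, …, b_n` is diagonal with positive diagonal entries. -/
def HasPositiveDiagonalBasis {n : ℕ} (S : AddSubgroup (Fin n → ℤ)) : Prop :=
  ∃ b : Module.Basis (Fin n) ℤ S,
    (Matrix.of fun i j => (b i : Fin n → ℤ) j).IsDiag ∧ ∀ i, 0 < (b i : Fin n → ℤ) i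

/-- Prime ideals of a (noncommutative) ring, in the elementwise form: `P ≠ A` and `a A b ⊆ P`
implies `a ∈ P` or `b ∈ P`. -/
def IsPrimeTwoSided {A : Type*} [Ring A] (P : TwoSidedIdeal A) : Prop :=
  P ≠ ⊤ ∧ ∀ a b : A, (∀ r, a * r * b ∈ P) → a ∈ P ∨ b ∈ P

/-- A prime ring: a ring whose zero ideal is prime. -/
def IsPrimeRing (A : Type*) [Ring A] : Prop := IsPrimeTwoSided (⊥ : TwoSidedIdeal A)

/-- A prime ideal of height one: the supremum of the lengths `m` of the chains of prime ideals
`P_0 < ⋯ < P_m = P` is one. -/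
def IsHeightOnePrime {A : Type*} [Ring A] (P : TwoSidedIdeal A) : Prop :=
  ∃ hP : IsPrimeTwoSided P,
    Order.height (⟨P, hP⟩ : {Q : TwoSidedIdeal A // IsPrimeTwoSided Q}) = 1

/-- A two-sided ideal `I` of `A` is principal if `I = aA = Aa` for some `a`. -/
def IsPrincipalTwoSided {A : Type*} [Ring A] (I : TwoSidedIdeal A) : Prop :=
  ∃ a : A, (∀ x, x ∈ I ↔ ∃ r, x = a * r) ∧ (∀ x, x ∈ I ↔ ∃ r, x = r * a)

/-- Unique factorization rings in the sense of Chatters and Jordan: (left and right) noetherian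
prime rings in which every height-one prime ideal is principal. -/
structure IsUniqueFactorizationRing (A : Type*) [Ring A] : Prop where
  noetherian_left : IsNoetherian A A
  noetherian_right : IsNoetherian Aᵐᵒᵖ A
  prime : IsPrimeRing A
  principal : ∀ P : TwoSidedIdeal A, IsHeightOnePrime P → IsPrincipalTwoSided P

/-! ### Factoriality of power series rings over an infinite field. -/

section PowerSeriesFactoriality

/-! The hypothesis on `S` says `S = ⨁ ℤ dᵢ eᵢ`. Hence `q i j ^ d i = 1`, so the ordered cocycle
itself, and not only `σ`, is trivial on `S`, and the `yᵢ = xᵢ ^ dᵢ` generate a central copy of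
`k[[y]]` (`embed`). The power series in `L` form a free `k[[y]]`-module on the monomials `x^t`, with
`t` in the box `0 ≤ tᵢ < dᵢ`, and `L` arises from them by inverting monomials in `y`. Chains of
one-sided ideals therefore inject into chains of submodules of a finite free module over the
noetherian ring `k[[y]]`.

Conjugation by `x^u` multiplies the coefficient at `s` by `σ(u,s)`, and these characters separate
the cosets of `S`. So every two-sided ideal is graded by `ℤⁿ/S` (`part_mem`). As each `x^t` is a
unit, such an ideal is controlled by the central series it contains (`embed_mem_of_combine_mem`).

It follows that `pL` is prime when `p` generates a prime ideal of `k[[y]]` containing no monomial,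
and that a nonzero prime `P` of `L` contracts to a nonzero prime of `k[[y]]`. The ring `k[[y]]` is
factorial, so this contraction contains a prime element `p`, and `0 < pL ≤ P`. Height one forces `P
= pL = Lp`. Factoriality is proved by induction on the number of variables, from Weierstrass
preparation and Kaplansky's criterion. -/

open PowerSeries in
/-- A prime ideal of `A⟦X⟧` containing a series that is regular in `X` contains a prime element, if
`A` is a complete local factorial ring. -/
theorem PowerSeries.exists_prime_mem_of_map_residue_ne_zero {A : Type*} [CommRing A] [IsDomain A]
    [IsLocalRing A] [UniqueFactorizationMonoid A] [IsAdicComplete (IsLocalRing.maximalIdeal A) A]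
    {P : Ideal A⟦X⟧} (hP : P.IsPrime) {g : A⟦X⟧} (hg : g ∈ P)
    (hreg : g.map (IsLocalRing.residue A) ≠ 0) : ∃ p ∈ P, Prime p := by
  obtain ⟨f, h, H⟩ := g.exists_isWeierstrassFactorization hreg
  have hfP : (f : A⟦X⟧) ∈ P := by
    have h1 := H.eq_mul ▸ hg
    rcases hP.mem_or_mem h1 with h2 | h2
    · exact h2
    · exact absurd (P.eq_top_of_isUnit_mem h2 H.isUnit) hP.ne_top
  let P₀ : Ideal (Polynomial A) := P.comap (Polynomial.coeToPowerSeries.ringHom (R := A))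
  have hP₀ : P₀.IsPrime := hP.comap _
  have hf : f.IsDistinguishedAt (IsLocalRing.maximalIdeal A) := H.isDistinguishedAt
  have hfP₀ : f ∈ P₀ := by
    simpa [P₀, Ideal.mem_comap] using hfP
  obtain ⟨p, hpmem, hpP⟩ : ∃ p ∈ UniqueFactorizationMonoid.factors f, p ∈ P₀ := by
    refine (hP₀.multiset_prod_mem_iff_exists_mem _).1 ?_
    obtain ⟨u, hu⟩ := UniqueFactorizationMonoid.factors_prod hf.monic.ne_zero
    rwa [← hu, Ideal.mul_unit_mem_iff_mem _ u.isUnit] at hfP₀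
  have hp : Prime p := UniqueFactorizationMonoid.prime_of_factor p hpmem
  have hpf : p ∣ f := UniqueFactorizationMonoid.dvd_of_mem_factors hpmem
  -- A factor of a monic polynomial over a domain has unit leading coefficient, so `p` can be
  -- rescaled to a monic `p'`.
  have hlead : IsUnit p.leadingCoeff := by
    obtain ⟨r, hr⟩ := hpf
    have := congrArg Polynomial.leadingCoeff hr
    rw [hf.monic.leadingCoeff, Polynomial.leadingCoeff_mul] at this
    exact IsUnit.of_mul_eq_one _ this.symm
  obtain ⟨u, hu⟩ := hlead
  let p' : Polynomial A := Polynomial.C (↑u⁻¹ : A) * p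
  have hmon : p'.Monic := by
    simp [p', Polynomial.Monic, Polynomial.leadingCoeff_mul, ← hu]
  have hCu : IsUnit (Polynomial.C (↑u⁻¹ : A)) := (u⁻¹).isUnit.map Polynomial.C
  have hass : Associated p p' := by
    obtain ⟨c, hc⟩ := hCu
    exact ⟨c, by simp only [p', ← hc]; ring⟩
  have hp' : Prime p' := hass.prime hp
  have hp'f : p' ∣ f := hass.dvd_iff_dvd_left.mp hpf
  have hp'P : p' ∈ P₀ := P₀.mul_mem_left _ hpP
  have hdist : p'.IsDistinguishedAt (IsLocalRing.maximalIdeal A) := by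
    refine ⟨⟨?_⟩, hmon⟩
    -- Modulo the maximal ideal `f` is a power of `X`, hence so is its monic divisor `p'`. This
    -- makes `p'` distinguished.
    have hmap : p'.map (IsLocalRing.residue A) ∣ Polynomial.X ^ f.natDegree := by
      have := Polynomial.map_dvd (IsLocalRing.residue A) hp'f
      rwa [show f.map (IsLocalRing.residue A) = Polynomial.X ^ f.natDegree from
        hf.map_eq_X_pow] at this
    obtain ⟨i, -, hi⟩ := (dvd_prime_pow Polynomial.prime_X _).1 hmap
    have hi' : p'.map (IsLocalRing.residue A) = Polynomial.X ^ i :=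
      Polynomial.eq_of_monic_of_associated (hmon.map _) (Polynomial.monic_X_pow i) hi
    have hdeg : p'.natDegree = i := by
      rw [← hmon.natDegree_map (IsLocalRing.residue A), hi', Polynomial.natDegree_X_pow]
    intro m hm
    have := congrArg (fun r => Polynomial.coeff r m) hi'
    simp only [Polynomial.coeff_map, Polynomial.coeff_X_pow] at this
    rw [if_neg (by omega)] at this
    exact (IsLocalRing.residue_eq_zero_iff _).1 this
  refine ⟨(p' : A⟦X⟧), by simpa [P₀, Ideal.mem_comap] using hp'P, ?_⟩
  have hne : (p' : A⟦X⟧) ≠ 0 := by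
    simpa using hmon.ne_zero
  rw [← Ideal.span_singleton_prime hne, ← Ideal.Quotient.isDomain_iff_prime]
  -- Weierstrass division identifies `A[X]/(p')` with `A⟦X⟧/(p')`, so primality passes from
  -- polynomials to power series.
  have : (Ideal.span {p'}).IsPrime := (Ideal.span_singleton_prime hmon.ne_zero).2 hp'
  have : IsDomain (Polynomial A ⧸ Ideal.span {p'}) := Ideal.Quotient.isDomain _
  exact hdist.algEquivQuotient.symm.toMulEquiv.isDomain _

namespace MvPowerSeries

theorem mem_span_range_X {σ R : Type*} [Finite σ] [CommRing R] {f : MvPowerSeries σ R}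
    (hf : constantCoeff f = 0) : f ∈ Ideal.span (Set.range (X : σ → MvPowerSeries σ R)) := by
  classical
  cases nonempty_fintype σ
  -- Variables are peeled off one at a time: `g` collects the monomials of `f` divisible by `X i`,
  -- and `f - g` involves only monomials divisible by a variable in the smaller set.
  have key : ∀ (s : Finset σ) (f : MvPowerSeries σ R),
      (∀ m : σ →₀ ℕ, (∀ i ∈ s, m i = 0) → coeff m f = 0) →
        f ∈ Ideal.span (Set.range (X : σ → MvPowerSeries σ R)) := by
    intro s
    induction s using Finset.induction_on with
    | empty =>
      intro f h
      have : f = 0 := by ext m; exact h m (by simp)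
      rw [this]
      exact zero_mem _
    | insert i s _ ih =>
      intro f h
      let g : MvPowerSeries σ R := fun m => if m i = 0 then 0 else coeff m f
      have hg : ∀ m, coeff m g = if m i = 0 then 0 else coeff m f := fun _ => rfl
      have h1 : X i ∣ g := X_dvd_iff.2 fun m hm => by rw [hg, if_pos hm]
      have h2 : f - g ∈ Ideal.span (Set.range (X : σ → MvPowerSeries σ R)) := by
        refine ih _ fun m hm => ?_
        rw [map_sub, hg]
        split_ifs with h0
        · rw [sub_zero]
          exact h m fun j hj => (Finset.mem_insert.1 hj).elim (fun e => e ▸ h0) (hm j)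
        · exact sub_self _
      have h3 : g ∈ Ideal.span (Set.range (X : σ → MvPowerSeries σ R)) :=
        Ideal.mem_of_dvd _ h1 (Ideal.subset_span ⟨i, rfl⟩)
      simpa using add_mem h2 h3
  refine key Finset.univ f fun m hm => ?_
  have : m = 0 := by ext i; exact hm i (Finset.mem_univ i)
  rw [this, coeff_zero_eq_constantCoeff_apply, hf]

variable {k : Type*} [Field k]

theorem mem_maximalIdeal_iff {σ : Type*} (f : MvPowerSeries σ k) :
    f ∈ IsLocalRing.maximalIdeal (MvPowerSeries σ k) ↔ constantCoeff f = 0 := by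
  rw [IsLocalRing.mem_maximalIdeal, mem_nonunits_iff, isUnit_iff_constantCoeff, isUnit_iff_ne_zero,
    not_not]

theorem maximalIdeal_eq_span_range_X (σ : Type*) [Finite σ] :
    IsLocalRing.maximalIdeal (MvPowerSeries σ k) = Ideal.span (Set.range X) := by
  refine le_antisymm (fun f hf => mem_span_range_X ((mem_maximalIdeal_iff f).1 hf)) ?_
  rw [Ideal.span_le]
  rintro _ ⟨i, rfl⟩
  exact (mem_maximalIdeal_iff _).2 (constantCoeff_X i)

instance isAdicComplete_maximalIdeal (σ : Type*) [Finite σ] :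
    IsAdicComplete (IsLocalRing.maximalIdeal (MvPowerSeries σ k)) (MvPowerSeries σ k) := by
  rw [maximalIdeal_eq_span_range_X]
  infer_instance

/-- The linear substitution `X 0 ↦ c₀ X 0`, `X i ↦ X i + cᵢ X 0` for `i ≠ 0`. -/
noncomputable def shear {n : ℕ} (c : Fin (n + 1) → k) (i : Fin (n + 1)) :
    MvPowerSeries (Fin (n + 1)) k :=
  (if i = 0 then 0 else X i) + C (c i) * X 0

theorem hasSubst_shear {n : ℕ} (c : Fin (n + 1) → k) : HasSubst (shear c) := by
  refine hasSubst_of_constantCoeff_zero fun i => ?_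
  by_cases hi : i = 0 <;> simp [shear, hi]

/-- The two hypotheses say that the linear substitutions attached to `c` and `c'` compose to the
identity on the variables. -/
theorem substAlgHom_shear_comp {n : ℕ} {c c' : Fin (n + 1) → k} (h0 : c 0 * c' 0 = 1)
    (h1 : ∀ i, i ≠ 0 → c' i + c i * c' 0 = 0) :
    (substAlgHom (R := k) (hasSubst_shear c')).comp (substAlgHom (hasSubst_shear c)) =
      AlgHom.id k _ := by
  have key : (fun s => substAlgHom (R := k) (hasSubst_shear c') (shear c s)) = X := by
    funext i
    have hC : ∀ a : k, substAlgHom (R := k) (hasSubst_shear c') (C a) = C a := fun a =>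
      (substAlgHom (R := k) (hasSubst_shear c')).commutes a
    by_cases hi : i = 0
    · subst hi
      rw [shear, if_pos rfl, zero_add, map_mul, hC, substAlgHom_X, shear, if_pos rfl, zero_add,
        ← mul_assoc, ← map_mul, h0, map_one, one_mul]
    · rw [shear, if_neg hi, map_add, map_mul, hC, substAlgHom_X, substAlgHom_X, shear, if_neg hi,
        shear, if_pos rfl, zero_add, ← mul_assoc, ← map_mul, add_assoc, ← add_mul, ← map_add, h1 i hi,
        map_zero, zero_mul, add_zero]
  refine AlgHom.ext fun f => ?_
  rw [AlgHom.comp_apply, substAlgHom_comp_substAlgHom_apply, substAlgHom_apply, key, subst_self]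
  rfl

/-- The change of variables given by `shear`. -/
noncomputable def shearEquiv {n : ℕ} (c : Fin (n + 1) → k) (h : c 0 ≠ 0) :
    MvPowerSeries (Fin (n + 1)) k ≃ₐ[k] MvPowerSeries (Fin (n + 1)) k :=
  AlgEquiv.ofAlgHom (substAlgHom (hasSubst_shear c))
    (substAlgHom (hasSubst_shear fun i => if i = 0 then (c 0)⁻¹ else -(c i * (c 0)⁻¹)))
    (substAlgHom_shear_comp (by simp [h]) fun i hi => by simp [hi, h])
    (substAlgHom_shear_comp (by simp [h]) fun i hi => by simp [hi])

/-- Setting all variables but the first one to zero. -/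
noncomputable def restrictFirst (k : Type*) [Field k] (n : ℕ) :
    MvPowerSeries (Fin (n + 1)) k →+* PowerSeries k :=
  (PowerSeries.map constantCoeff).comp (finSuccEquiv k n).toAlgHom.toRingHom

theorem restrictFirst_shear {n : ℕ} (c : Fin (n + 1) → k) (i : Fin (n + 1)) :
    restrictFirst k n (shear c i) = PowerSeries.C (c i) * PowerSeries.X := by
  have hC : finSuccEquiv k n (C (c i)) = PowerSeries.C (C (c i)) := finSuccEquiv_C _
  refine Fin.cases ?_ (fun j => ?_) i <;> simp [restrictFirst, shear, Fin.succ_ne_zero]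

theorem coeff_restrictFirst {n : ℕ} (f : MvPowerSeries (Fin (n + 1)) k) (m : ℕ) :
    PowerSeries.coeff m (restrictFirst k n f) = coeff (Finsupp.cons m 0) f := by
  simp only [restrictFirst, RingHom.comp_apply, PowerSeries.coeff_map]
  rw [← coeff_zero_eq_constantCoeff_apply]
  exact coeff_coeff_finSuccEquiv f

/-- Shearing and then killing all variables but the first restricts `f` to the line through `c`; its
degree `m` coefficient is the homogeneous component of degree `m` evaluated at `c`. -/
theorem coeff_restrictFirst_shearEquiv {n : ℕ} (c : Fin (n + 1) → k) (h : c 0 ≠ 0)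
    (f : MvPowerSeries (Fin (n + 1)) k) (m : ℕ) :
    PowerSeries.coeff m (restrictFirst k n (shearEquiv c h f)) =
      ∑ s ∈ Finset.univ.finsuppAntidiag m, coeff s f * s.prod fun i e => c i ^ e := by
  have h1 : shearEquiv c h f = subst (shear c) f := substAlgHom_apply (hasSubst_shear c) f
  rw [coeff_restrictFirst, h1, coeff_subst (hasSubst_shear c)]
  have h2 : ∀ s : Fin (n + 1) →₀ ℕ,
      coeff (Finsupp.cons m 0) (s.prod fun i e => shear c i ^ e) =
        if ∑ i, s i = m then s.prod fun i e => c i ^ e else 0 := by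
    intro s
    rw [← coeff_restrictFirst, Finsupp.prod_fintype _ _ (by simp), map_prod,
      Finsupp.prod_fintype _ _ (by simp)]
    simp only [map_pow, restrictFirst_shear, mul_pow, Finset.prod_mul_distrib,
      Finset.prod_pow_eq_pow_sum]
    simp only [← map_pow, ← map_prod]
    rw [PowerSeries.coeff_C_mul, PowerSeries.coeff_X_pow]
    simp [eq_comm]
  simp only [h2, smul_eq_mul]
  rw [finsum_eq_sum_of_support_subset (s := Finset.univ.finsuppAntidiag m)]
  · refine Finset.sum_congr rfl fun s hs => ?_
    rw [if_pos (Finset.mem_finsuppAntidiag.1 hs).1]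
  · intro s hs
    simp only [Function.mem_support, ne_eq, mul_eq_zero, not_or] at hs
    simp only [Finset.mem_coe, Finset.mem_finsuppAntidiag, Finset.subset_univ, and_true]
    by_contra h
    exact hs.2 (if_neg h)

/-- Every nonzero power series over an infinite field becomes regular in the first variable after a
linear change of variables. -/
theorem exists_algEquiv_map_residue_ne_zero [Infinite k] {n : ℕ}
    {f : MvPowerSeries (Fin (n + 1)) k} (hf : f ≠ 0) :
    ∃ e : MvPowerSeries (Fin (n + 1)) k ≃ₐ[k] MvPowerSeries (Fin (n + 1)) k,
      (finSuccEquiv k n (e f)).map (IsLocalRing.residue (MvPowerSeries (Fin n) k)) ≠ 0 := by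
  obtain ⟨s₀, hs₀⟩ : ∃ s, coeff s f ≠ 0 := by
    by_contra! h
    exact hf (ext h)
  let m := ∑ i, s₀ i
  let F : MvPolynomial (Fin (n + 1)) k :=
    ∑ s ∈ Finset.univ.finsuppAntidiag m, MvPolynomial.monomial s (coeff s f)
  have hF : F ≠ 0 := by
    intro h
    have := congrArg (MvPolynomial.coeff s₀) h
    rw [MvPolynomial.coeff_sum, Finset.sum_eq_single s₀] at this
    · simp [hs₀] at this
    · intro s _ hs
      simp [MvPolynomial.coeff_monomial, hs]
    · intro h
      exact absurd (by simp [Finset.mem_finsuppAntidiag, m]) h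
  -- The extra factor `X 0` forces `c 0 ≠ 0`, which makes the shear invertible.
  obtain ⟨c, hc⟩ : ∃ c : Fin (n + 1) → k, MvPolynomial.eval c (F * MvPolynomial.X 0) ≠ 0 := by
    by_contra! h
    exact mul_ne_zero hF (MvPolynomial.X_ne_zero 0) (MvPolynomial.funext fun c => by rw [h c, map_zero])
  rw [map_mul, MvPolynomial.eval_X] at hc
  have hc0 : c 0 ≠ 0 := right_ne_zero_of_mul hc
  refine ⟨shearEquiv c hc0, fun h => left_ne_zero_of_mul hc ?_⟩
  have h1 := congrArg (PowerSeries.coeff m) h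
  rw [PowerSeries.coeff_map, map_zero, IsLocalRing.residue_eq_zero_iff, mem_maximalIdeal_iff] at h1
  have h2 := coeff_restrictFirst_shearEquiv c hc0 f m
  simp only [restrictFirst, RingHom.comp_apply, PowerSeries.coeff_map] at h2
  rw [map_sum]
  simp only [MvPolynomial.eval_monomial]
  exact h2.symm.trans h1

/-- By Kaplansky's criterion it suffices to find a prime element in each nonzero prime ideal. After
a linear change of variables the ideal contains a series regular in the first variable, over the
ring in the remaining ones, which is factorial by induction. -/
theorem uniqueFactorizationMonoid_fin [Infinite k] (n : ℕ) :
    UniqueFactorizationMonoid (MvPowerSeries (Fin n) k) := by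
  induction n with
  | zero =>
    exact (isEmptyEquiv (Fin 0) k).symm.toMulEquiv.uniqueFactorizationMonoid inferInstance
  | succ n ih =>
    have : IsDomain (MvPowerSeries (Fin (n + 1)) k) := NoZeroDivisors.to_isDomain _
    have : IsDomain (MvPowerSeries (Fin n) k) := NoZeroDivisors.to_isDomain _
    rw [UniqueFactorizationMonoid.iff_exists_prime_mem_of_isPrime]
    intro P hP hPprime
    obtain ⟨f, hfP, hf⟩ := Submodule.exists_mem_ne_zero_of_ne_bot hP
    obtain ⟨e, he⟩ := exists_algEquiv_map_residue_ne_zero hf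
    let E : MvPowerSeries (Fin (n + 1)) k ≃+* PowerSeries (MvPowerSeries (Fin n) k) :=
      (e.trans (finSuccEquiv k n)).toRingEquiv
    have hQ : (P.comap E.symm.toRingHom).IsPrime := hPprime.comap _
    obtain ⟨p, hpP, hp⟩ := PowerSeries.exists_prime_mem_of_map_residue_ne_zero hQ (g := E f)
      (by simpa [Ideal.mem_comap] using hfP) he
    exact ⟨E.symm p, hpP, (MulEquiv.prime_iff E.symm).2 hp⟩

end MvPowerSeries

end PowerSeriesFactoriality

/-! ### The commutation form, its radical and the ordered cocycle. -/

section Bicharacter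

variable {k : Type*} [Field k] {n : ℕ} {q : Fin n → Fin n → kˣ}

theorem qSigma_add_right (s t t' : Fin n → ℤ) :
    qSigma q s (t + t') = qSigma q s t * qSigma q s t' := by
  simp [qSigma, mul_add, zpow_add, Finset.prod_mul_distrib]

theorem qSigma_sub_right (s t t' : Fin n → ℤ) :
    qSigma q s (t - t') = qSigma q s t / qSigma q s t' := by
  rw [eq_div_iff_mul_eq', ← qSigma_add_right, sub_add_cancel]

theorem qSigma_swap (hq : ∀ i j, q i j = (q j i)⁻¹) (s t : Fin n → ℤ) :
    qSigma q s t = (qSigma q t s)⁻¹ := by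
  simp only [qSigma]
  rw [Finset.prod_comm]
  simp only [← Finset.prod_inv_distrib]
  refine Finset.prod_congr rfl fun i _ => Finset.prod_congr rfl fun j _ => ?_
  rw [hq j i, inv_zpow, mul_comm]

theorem qSigma_single_single (i j : Fin n) (a b : ℤ) :
    qSigma q (Pi.single i a) (Pi.single j b) = q i j ^ (a * b) := by
  rw [qSigma, Finset.prod_eq_single i, Finset.prod_eq_single j]
  · simp
  · intro c _ hc; simp [Pi.single_eq_of_ne hc]
  · simp
  · intro c _ hc; simp [Pi.single_eq_of_ne hc]
  · simp

/-- The factors of `σ` below the diagonal give `c(s,t)`, those above give `c(t,s)⁻¹`, and those on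
it are trivial. This is the relation `x^s x^t = σ(s,t) x^t x^s`. -/
theorem qCocycle_eq_qSigma_mul (hd : ∀ i, q i i = 1) (hq : ∀ i j, q i j = (q j i)⁻¹)
    (s t : Fin n → ℤ) : qCocycle q s t = qSigma q s t * qCocycle q t s := by
  have h : (qCocycle q t s)⁻¹ = ∏ i, ∏ j, if i < j then q i j ^ (s i * t j) else 1 := by
    rw [qCocycle, Finset.prod_comm]
    simp only [← Finset.prod_inv_distrib]
    refine Finset.prod_congr rfl fun i _ => Finset.prod_congr rfl fun j _ => ?_
    split_ifs
    · rw [hq i j, inv_zpow, mul_comm]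
    · simp
  rw [← mul_inv_eq_iff_eq_mul, h, qCocycle, qSigma]
  simp only [← Finset.prod_mul_distrib]
  refine Finset.prod_congr rfl fun i _ => Finset.prod_congr rfl fun j _ => ?_
  rcases lt_trichotomy i j with h | rfl | h
  · simp [h, h.not_gt]
  · simp [hd]
  · simp [h, h.not_gt]

/-- The radical of the commutation form is the diagonal lattice `⨁ ℤ dᵢ eᵢ`. -/
structure IsRadicalDiagonal (q : Fin n → Fin n → kˣ) (d : Fin n → ℕ) : Prop where
  diag : ∀ i, q i i = 1
  anti : ∀ i j, q i j = (q j i)⁻¹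
  pos : ∀ i, 0 < d i
  mem_iff : ∀ s, s ∈ qRadical q ↔ ∀ i, (d i : ℤ) ∣ s i

theorem exists_isRadicalDiagonal (hd : ∀ i, q i i = 1) (hq : ∀ i j, q i j = (q j i)⁻¹)
    (hS : HasPositiveDiagonalBasis (qRadical q)) : ∃ d, IsRadicalDiagonal q d := by
  obtain ⟨b, hb, hpos⟩ := hS
  have hb' : ∀ i j, i ≠ j → (b i : Fin n → ℤ) j = 0 := fun i j h => hb h
  have hcast : ∀ i, (((b i : Fin n → ℤ) i).toNat : ℤ) = (b i : Fin n → ℤ) i := fun i =>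
    Int.toNat_of_nonneg (hpos i).le
  have hsum : ∀ (c : Fin n → ℤ) j, ((∑ i, c i • b i : qRadical q) : Fin n → ℤ) j =
      c j * (b j : Fin n → ℤ) j := by
    intro c j
    rw [AddSubgroup.val_finsetSum, Finset.sum_apply, Finset.sum_eq_single j]
    · simp
    · intro i _ hi
      simp [hb' i j hi]
    · simp
  refine ⟨fun i => ((b i : Fin n → ℤ) i).toNat, hd, hq, fun i => ?_,
    fun s => ⟨fun hs i => ?_, fun h => ?_⟩⟩
  · have := hpos i
    omega
  · have := hsum (fun i => b.repr ⟨s, hs⟩ i) i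
    rw [b.sum_repr] at this
    rw [hcast]
    exact ⟨_, this.trans (mul_comm _ _)⟩
  · choose c hc using h
    have : s = ((∑ i, c i • b i : qRadical q) : Fin n → ℤ) := by
      funext j
      rw [hsum, hc, hcast, mul_comm]
    rw [this]
    exact SetLike.coe_mem _

namespace IsRadicalDiagonal

variable {d : Fin n → ℕ} (h : IsRadicalDiagonal q d)
include h

theorem pow_left (i j : Fin n) : q i j ^ (d i : ℤ) = 1 := by
  have h1 : (Pi.single i (d i : ℤ) : Fin n → ℤ) ∈ qRadical q := by
    rw [h.mem_iff]
    intro l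
    by_cases hl : l = i
    · subst hl; simp
    · simp [Pi.single_eq_of_ne hl]
  have h2 := h1 (Pi.single j 1)
  rwa [qSigma_single_single, mul_one] at h2

theorem pow_right (i j : Fin n) : q i j ^ (d j : ℤ) = 1 := by
  rw [h.anti, inv_zpow, h.pow_left, inv_one]

/-- Here diagonality of `S` matters: each factor `q i j ^ (s i * t j)` is trivial separately because
`d i ∣ s i`, whereas membership in `S` by itself only controls `σ`. -/
theorem qCocycle_left {s : Fin n → ℤ} (hs : s ∈ qRadical q) (t : Fin n → ℤ) :
    qCocycle q s t = 1 := by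
  rw [qCocycle]
  refine Finset.prod_eq_one fun i _ => Finset.prod_eq_one fun j _ => ?_
  split_ifs
  · obtain ⟨c, hc⟩ := (h.mem_iff s).1 hs i
    rw [hc, mul_assoc, zpow_mul, h.pow_left, one_zpow]
  · rfl

theorem qCocycle_right {s : Fin n → ℤ} (hs : s ∈ qRadical q) (t : Fin n → ℤ) :
    qCocycle q t s = 1 := by
  rw [qCocycle]
  refine Finset.prod_eq_one fun i _ => Finset.prod_eq_one fun j _ => ?_
  split_ifs
  · obtain ⟨c, hc⟩ := (h.mem_iff s).1 hs j
    rw [hc, mul_left_comm, zpow_mul, h.pow_right, one_zpow]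
  · rfl

theorem exists_qSigma_ne {t t' : Fin n → ℤ} (ht : t - t' ∉ qRadical q) :
    ∃ u, qSigma q u t ≠ qSigma q u t' := by
  by_contra! hu
  refine ht fun u => ?_
  rw [qSigma_swap h.anti, qSigma_sub_right, hu, div_self', inv_one]

end IsRadicalDiagonal

end Bicharacter

/-! ### Conjugation by monomials and the grading by `ℤⁿ/S`. -/

namespace QLaurent

variable {k : Type*} [Field k] {n : ℕ} {q : Fin n → Fin n → kˣ}

/-- The constant series. -/
def const (q : Fin n → Fin n → kˣ) (c : k) : QLaurent q :=
  ⟨Pi.single 0 c, 0, fun _ ⟨i, hi⟩ => Pi.single_eq_of_ne (fun e => by simp [e] at hi) _⟩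

theorem coeff_const_mul (c : k) (f : QLaurent q) (u : Fin n → ℤ) :
    (const q c * f).coeff u = c * f.coeff u := by
  rw [coeff_mul, finsum_eq_single _ 0]
  · simp [const, qCocycle_zero_left]
  · intro s hs
    simp [const, Pi.single_eq_of_ne hs]

theorem coeff_mul_monomial (f : QLaurent q) (s u : Fin n → ℤ) :
    (f * monomial q s).coeff u = (qCocycle q (u - s) s : k) * f.coeff (u - s) := by
  rw [coeff_mul, finsum_eq_single _ (u - s)]
  · simp [monomial]
  · intro t ht
    have : u - t ≠ s := fun e => ht (by rw [← e]; abel)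
    simp [monomial, Pi.single_eq_of_ne this]

theorem coeff_sub (f g : QLaurent q) (u : Fin n → ℤ) :
    (f - g).coeff u = f.coeff u - g.coeff u := by
  rw [sub_eq_add_neg, coeff_add, coeff_neg, Pi.add_apply, Pi.neg_apply, sub_eq_add_neg]

theorem coeff_sum {ι : Type*} (T : Finset ι) (f : ι → QLaurent q) (u : Fin n → ℤ) :
    (∑ i ∈ T, f i).coeff u = ∑ i ∈ T, (f i).coeff u := by
  classical
  induction T using Finset.induction_on with
  | empty => simp [coeff_zero]
  | insert i T hi ih => rw [Finset.sum_insert hi, Finset.sum_insert hi, coeff_add, Pi.add_apply, ih]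

theorem monomial_zero : monomial q 0 = 1 := rfl

theorem isUnit_monomial (s : Fin n → ℤ) : IsUnit (monomial q s) := by
  have key : ∀ s t : Fin n → ℤ, s + t = 0 →
      const q ((qCocycle q s t)⁻¹ : kˣ) * (monomial q s * monomial q t) = 1 := by
    intro s t h
    ext u
    rw [coeff_const_mul, coeff_monomial_mul_monomial, h, monomial_zero, ← mul_assoc, ← Units.val_mul,
      inv_mul_cancel, Units.val_one, one_mul]
  have hl := key (-s) s (neg_add_cancel s)
  have hr := key s (-s) (add_neg_cancel s)
  rw [← mul_assoc] at hl
  have hcomm : ∀ (c : k) (f : QLaurent q), const q c * f = f * const q c := by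
    intro c f
    ext u
    rw [coeff_const_mul, coeff_mul, finsum_eq_single _ u]
    · simp [const, qCocycle_zero_right, mul_comm]
    · intro t ht
      simp [const, Pi.single_eq_of_ne (sub_ne_zero.mpr ht.symm)]
  rw [hcomm, mul_assoc] at hr
  exact isUnit_iff_exists_and_exists.mpr ⟨⟨_, hr⟩, ⟨_, hl⟩⟩

/-- The series with coefficients `w s • f s`. -/
def reweight (w : (Fin n → ℤ) → k) (f : QLaurent q) : QLaurent q :=
  ⟨fun s => w s * f.coeff s, by
    obtain ⟨N, hN⟩ := f.bounded
    exact ⟨N, fun s hs => by rw [hN s hs, mul_zero]⟩⟩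

open Classical in
/-- The part of `f` supported on the coset `t + S`. -/
noncomputable def part (f : QLaurent q) (t : Fin n → ℤ) : QLaurent q :=
  reweight (fun s => if s - t ∈ qRadical q then 1 else 0) f

theorem coeff_part_of_mem {f : QLaurent q} {t s : Fin n → ℤ} (h : s - t ∈ qRadical q) :
    (part f t).coeff s = f.coeff s := by
  simp [part, reweight, h]

theorem coeff_part_of_notMem {f : QLaurent q} {t s : Fin n → ℤ} (h : s - t ∉ qRadical q) :
    (part f t).coeff s = 0 := by
  simp [part, reweight, h]

end QLaurent

namespace IsRadicalDiagonal

open QLaurent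

variable {k : Type*} [Field k] {n : ℕ} {q : Fin n → Fin n → kˣ} {d : Fin n → ℕ}

theorem monomial_mul_eq_reweight_mul (h : IsRadicalDiagonal q d) (u : Fin n → ℤ) (f : QLaurent q) :
    monomial q u * f = reweight (fun s => (qSigma q u s : k)) f * monomial q u := by
  ext v
  rw [coeff_monomial_mul, coeff_mul_monomial, qCocycle_eq_qSigma_mul h.diag h.anti u]
  simp only [reweight, Units.val_mul]
  ring

theorem reweight_mem (h : IsRadicalDiagonal q d) {I : TwoSidedIdeal (QLaurent q)} {f : QLaurent q}
    (hf : f ∈ I) (u : Fin n → ℤ) : reweight (fun s => (qSigma q u s : k)) f ∈ I := by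
  obtain ⟨v, hv⟩ := isUnit_monomial (q := q) u
  have : reweight (fun s => (qSigma q u s : k)) f = monomial q u * f * (↑v⁻¹ : QLaurent q) := by
    rw [h.monomial_mul_eq_reweight_mul, ← hv, mul_assoc, Units.mul_inv, mul_one]
  rw [this]
  exact I.mul_mem_right _ _ (I.mul_mem_left _ _ hf)

/-- Representatives of `ℤⁿ / S`. -/
noncomputable def box (d : Fin n → ℕ) : Finset (Fin n → ℤ) :=
  Fintype.piFinset fun i => Finset.Ico 0 (d i : ℤ)

theorem mem_box {t : Fin n → ℤ} : t ∈ box d ↔ ∀ i, 0 ≤ t i ∧ t i < d i := by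
  simp [box]

variable (h : IsRadicalDiagonal q d)
include h

theorem zero_mem_box : 0 ∈ box d := mem_box.2 fun i => ⟨le_rfl, by simpa using h.pos i⟩

theorem exists_mem_box (s : Fin n → ℤ) : ∃ t ∈ box d, s - t ∈ qRadical q := by
  have hd : ∀ i, (0 : ℤ) < d i := fun i => by exact_mod_cast h.pos i
  refine ⟨fun i => s i % d i, mem_box.2 fun i =>
    ⟨Int.emod_nonneg _ (hd i).ne', Int.emod_lt_of_pos _ (hd i)⟩,
    (h.mem_iff _).2 fun i => ?_⟩
  exact Int.dvd_self_sub_emod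

theorem eq_of_mem_box {t t' : Fin n → ℤ} (ht : t ∈ box d) (ht' : t' ∈ box d)
    (hS : t - t' ∈ qRadical q) : t = t' := by
  funext i
  have h1 := (h.mem_iff _).1 hS i
  have h2 := mem_box.1 ht i
  have h3 := mem_box.1 ht' i
  have := Int.eq_zero_of_abs_lt_dvd h1 (by rw [Pi.sub_apply, abs_lt]; constructor <;> linarith)
  simp only [Pi.sub_apply] at this
  linarith

theorem sum_part (f : QLaurent q) : ∑ t ∈ box d, part f t = f := by
  ext u
  rw [coeff_sum]
  obtain ⟨t, ht, hut⟩ := h.exists_mem_box u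
  rw [Finset.sum_eq_single t, coeff_part_of_mem hut]
  · intro t' ht' hne
    refine coeff_part_of_notMem fun hut' => hne (h.eq_of_mem_box ht' ht ?_)
    have := sub_mem hut hut'
    rwa [sub_sub_sub_cancel_left] at this
  · exact fun hn => absurd ht hn

theorem qSigma_eq_of_sub_mem {s t : Fin n → ℤ} (hst : s - t ∈ qRadical q) (u : Fin n → ℤ) :
    qSigma q u s = qSigma q u t := by
  have h1 : qSigma q u (s - t) = 1 := by rw [qSigma_swap h.anti, hst u, inv_one]
  rwa [qSigma_sub_right, div_eq_one] at h1

/-- The homogeneous parts (with respect to `ℤⁿ / S`) of an element of a two-sided ideal belong to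
the ideal. -/
theorem part_mem {I : TwoSidedIdeal (QLaurent q)} {f : QLaurent q} (hf : f ∈ I) {t : Fin n → ℤ}
    (ht : t ∈ box d) : part f t ∈ I := by
  classical
  -- As in Lagrange interpolation, the components other than `t` are killed one at a time. If
  -- `σ(u,·)` separates `t` from `t'`, then `x^u g x^{-u} - σ(u,t') g`, divided by `σ(u,t) -
  -- σ(u,t')`, loses the component at `t'`, keeps the one at `t`, and revives none already killed.
  have key : ∀ T : Finset (Fin n → ℤ), T ⊆ (box d).erase t → ∃ g ∈ I, part g t = part f t ∧
      ∀ t' ∈ T, part g t' = 0 := by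
    intro T
    induction T using Finset.induction_on with
    | empty => exact fun _ => ⟨f, hf, rfl, by simp⟩
    | insert t' T _ ih =>
      intro hT
      obtain ⟨g, hg, hgt, hgT⟩ := ih ((Finset.subset_insert _ _).trans hT)
      have ht' := Finset.mem_erase.1 (hT (Finset.mem_insert_self t' T))
      obtain ⟨u, hu⟩ := h.exists_qSigma_ne (t := t) (t' := t')
        fun hS => ht'.1 (h.eq_of_mem_box ht ht'.2 hS).symm
      have hu' : (qSigma q u t : k) - qSigma q u t' ≠ 0 := sub_ne_zero.2 fun e => hu (Units.ext e)
      let g' := const q ((qSigma q u t : k) - qSigma q u t')⁻¹ *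
        (reweight (fun s => (qSigma q u s : k)) g - const q (qSigma q u t' : k) * g)
      have hg' : ∀ s, g'.coeff s = ((qSigma q u t : k) - qSigma q u t')⁻¹ *
          ((qSigma q u s : k) - qSigma q u t') * g.coeff s := by
        intro s
        rw [coeff_const_mul, coeff_sub, coeff_const_mul]
        simp only [reweight]
        ring
      refine ⟨g', I.mul_mem_left _ _ (I.sub_mem (h.reweight_mem hg u) (I.mul_mem_left _ _ hg)), ?_, ?_⟩
      · rw [← hgt]
        ext s
        by_cases hs : s - t ∈ qRadical q
        · rw [coeff_part_of_mem hs, coeff_part_of_mem hs, hg', h.qSigma_eq_of_sub_mem hs,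
            inv_mul_cancel₀ hu', one_mul]
        · rw [coeff_part_of_notMem hs, coeff_part_of_notMem hs]
      · intro r hr
        ext s
        by_cases hs : s - r ∈ qRadical q
        · rw [coeff_part_of_mem hs, hg', coeff_zero, Pi.zero_apply]
          rcases Finset.mem_insert.1 hr with rfl | hr
          · rw [h.qSigma_eq_of_sub_mem hs, sub_self, mul_zero, zero_mul]
          · rw [← coeff_part_of_mem hs, hgT r hr, coeff_zero, Pi.zero_apply, mul_zero]
        · rw [coeff_part_of_notMem hs, coeff_zero, Pi.zero_apply]
  obtain ⟨g, hg, hgt, hgT⟩ := key _ subset_rfl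
  rw [← hgt]
  have := h.sum_part g
  rw [Finset.sum_eq_single t (fun t' ht' hne => hgT t' (Finset.mem_erase.2 ⟨hne, ht'⟩))
    (fun hn => absurd ht hn)] at this
  rwa [this]

end IsRadicalDiagonal

/-! ### The central power series ring and the free module over it. -/

namespace IsRadicalDiagonal

open QLaurent

variable {k : Type*} [Field k] {n : ℕ} {q : Fin n → Fin n → kˣ} {d : Fin n → ℕ}

/-- The exponents of the central monomials that are power series. -/
def scale (d : Fin n → ℕ) (v : Fin n →₀ ℕ) : Fin n → ℤ := fun i => d i * v i

theorem scale_add (v w : Fin n →₀ ℕ) : scale d (v + w) = scale d v + scale d w := by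
  funext i
  simp [scale, mul_add]

theorem scale_zero : scale d 0 = 0 := by
  funext i
  simp [scale]

theorem scale_nonneg (v : Fin n →₀ ℕ) (i : Fin n) : 0 ≤ scale d v i :=
  mul_nonneg (Int.natCast_nonneg _) (Int.natCast_nonneg _)

/-- The series in the monomials `x^(d v)` with the coefficients of `F`. -/
noncomputable def embedSeries (q : Fin n → Fin n → kˣ) (d : Fin n → ℕ)
    (F : MvPowerSeries (Fin n) k) : QLaurent q :=
  ⟨Function.extend (scale d) (fun v => MvPowerSeries.coeff v F) 0, 0, by
    rintro s ⟨i, hi⟩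
    refine Function.extend_apply' _ _ _ ?_
    rintro ⟨v, rfl⟩
    exact absurd hi (not_lt.2 (scale_nonneg v i))⟩

theorem coeff_embedSeries_of_forall_ne (F : MvPowerSeries (Fin n) k) {s : Fin n → ℤ}
    (hs : ¬ ∃ v, scale d v = s) : (embedSeries q d F).coeff s = 0 :=
  Function.extend_apply' _ _ _ hs

variable (h : IsRadicalDiagonal q d)
include h

theorem scale_injective : Function.Injective (scale d) := by
  intro v w hvw
  ext i
  have h1 := congrFun hvw i
  simpa [scale, (h.pos i).ne'] using h1

theorem scale_mem (v : Fin n →₀ ℕ) : scale d v ∈ qRadical q :=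
  (h.mem_iff _).2 fun _ => dvd_mul_right _ _

theorem exists_scale_eq {s : Fin n → ℤ} (hs : s ∈ qRadical q) (h0 : ∀ i, 0 ≤ s i) :
    ∃ v, scale d v = s := by
  choose c hc using (h.mem_iff s).1 hs
  refine ⟨Finsupp.equivFunOnFinite.symm fun i => (c i).toNat, ?_⟩
  funext i
  have h1 : 0 ≤ c i := by
    have h2 := h0 i
    rw [hc] at h2
    exact nonneg_of_mul_nonneg_right h2 (by exact_mod_cast h.pos i)
  simp [scale, Int.toNat_of_nonneg h1, ← hc]

theorem coeff_embedSeries_scale (F : MvPowerSeries (Fin n) k) (v : Fin n →₀ ℕ) :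
    (embedSeries q d F).coeff (scale d v) = MvPowerSeries.coeff v F :=
  h.scale_injective.extend_apply _ _ _

/-- The embedding of the commutative power series ring in the central variables
`yᵢ = xᵢ ^ dᵢ` into the Laurent series ring. -/
noncomputable def embed : MvPowerSeries (Fin n) k →+* QLaurent q where
  toFun := embedSeries q d
  map_zero' := by
    ext s
    by_cases hs : ∃ v, scale d v = s
    · obtain ⟨v, rfl⟩ := hs
      simp [h.coeff_embedSeries_scale, coeff_zero]
    · simp [coeff_embedSeries_of_forall_ne _ hs, coeff_zero]
  map_one' := by
    ext s
    by_cases hs : ∃ v, scale d v = s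
    · obtain ⟨v, rfl⟩ := hs
      rw [h.coeff_embedSeries_scale, coeff_one, MvPowerSeries.coeff_one]
      split_ifs with hv
      · simp [hv, scale_zero]
      · rw [Pi.single_eq_of_ne]
        exact fun e => hv (h.scale_injective (e.trans scale_zero.symm))
    · rw [coeff_embedSeries_of_forall_ne _ hs, coeff_one, Pi.single_eq_of_ne]
      rintro rfl
      exact hs ⟨0, scale_zero⟩
  map_add' F G := by
    ext s
    rw [coeff_add, Pi.add_apply]
    by_cases hs : ∃ v, scale d v = s
    · obtain ⟨v, rfl⟩ := hs
      simp [h.coeff_embedSeries_scale]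
    · simp [coeff_embedSeries_of_forall_ne _ hs]
  map_mul' F G := by
    classical
    ext s
    rw [coeff_mul]
    by_cases hs : ∃ v, scale d v = s
    · obtain ⟨v, rfl⟩ := hs
      rw [h.coeff_embedSeries_scale, MvPowerSeries.coeff_mul,
        finsum_eq_sum_of_support_subset
          (s := (Finset.HasAntidiagonal.antidiagonal v).image fun p => scale d p.1), Finset.sum_image]
      · refine Finset.sum_congr rfl fun p hp => ?_
        rw [← Finset.HasAntidiagonal.mem_antidiagonal.1 hp, scale_add, add_sub_cancel_left,
          h.coeff_embedSeries_scale, h.coeff_embedSeries_scale,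
          h.qCocycle_left (h.scale_mem _), Units.val_one, one_mul]
      · intro p hp p' hp' e
        have h1 : p.1 = p'.1 := h.scale_injective e
        have h2 := (Finset.HasAntidiagonal.mem_antidiagonal.1 hp).trans
          (Finset.HasAntidiagonal.mem_antidiagonal.1 hp').symm
        rw [h1] at h2
        exact Prod.ext h1 (add_left_cancel h2)
      · intro t ht
        have h1 : ∃ a, scale d a = t := by
          by_contra hn
          exact ht (by simp [coeff_embedSeries_of_forall_ne _ hn])
        have h2 : ∃ b, scale d b = scale d v - t := by
          by_contra hn
          exact ht (by simp [coeff_embedSeries_of_forall_ne _ hn])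
        obtain ⟨a, rfl⟩ := h1
        obtain ⟨b, hb⟩ := h2
        refine Finset.mem_coe.2 (Finset.mem_image.2 ⟨(a, b),
          Finset.HasAntidiagonal.mem_antidiagonal.2 ?_, rfl⟩)
        refine h.scale_injective ?_
        rw [scale_add, hb, add_sub_cancel]
    · rw [coeff_embedSeries_of_forall_ne _ hs]
      refine (finsum_eq_zero_of_forall_eq_zero fun t => ?_).symm
      by_cases h1 : ∃ a, scale d a = t
      · by_cases h2 : ∃ b, scale d b = s - t
        · obtain ⟨a, rfl⟩ := h1
          obtain ⟨b, hb⟩ := h2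
          exact absurd ⟨a + b, by rw [scale_add, hb, add_sub_cancel]⟩ hs
        · simp [coeff_embedSeries_of_forall_ne _ h2]
      · simp [coeff_embedSeries_of_forall_ne _ h1]

theorem coeff_embed_scale (F : MvPowerSeries (Fin n) k) (v : Fin n →₀ ℕ) :
    (h.embed F).coeff (scale d v) = MvPowerSeries.coeff v F :=
  h.scale_injective.extend_apply _ _ _

theorem coeff_embed_of_forall_ne (F : MvPowerSeries (Fin n) k) {s : Fin n → ℤ}
    (hs : ¬ ∃ v, scale d v = s) : (h.embed F).coeff s = 0 :=
  Function.extend_apply' _ _ _ hs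

theorem coeff_embed_of_notMem (F : MvPowerSeries (Fin n) k) {s : Fin n → ℤ}
    (hs : s ∉ qRadical q) : (h.embed F).coeff s = 0 :=
  h.coeff_embed_of_forall_ne F fun ⟨v, hv⟩ => hs (hv ▸ h.scale_mem v)

theorem embed_injective : Function.Injective h.embed := by
  intro F G e
  ext v
  rw [← h.coeff_embed_scale, e, h.coeff_embed_scale]

/-- The support of `h.embed F` lies in `S`, where the cocycle is trivial on both sides, so the two
convolutions agree after `s ↦ u - s`. -/
theorem embed_mul_comm (F : MvPowerSeries (Fin n) k) (g : QLaurent q) :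
    h.embed F * g = g * h.embed F := by
  have key : ∀ s t : Fin n → ℤ,
      (qCocycle q s t : k) * ((h.embed F).coeff s * g.coeff t) = (h.embed F).coeff s * g.coeff t ∧
      (qCocycle q t s : k) * (g.coeff t * (h.embed F).coeff s) = (h.embed F).coeff s * g.coeff t := by
    intro s t
    by_cases hs : s ∈ qRadical q
    · rw [h.qCocycle_left hs, h.qCocycle_right hs, Units.val_one, one_mul, one_mul, mul_comm]
      exact ⟨rfl, rfl⟩
    · simp [h.coeff_embed_of_notMem F hs]
  ext u
  rw [coeff_mul, coeff_mul, ← finsum_comp_equiv (Equiv.subLeft u)]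
  refine finsum_congr fun s => ?_
  simp only [Equiv.subLeft_apply, sub_sub_cancel]
  rw [(key _ _).1, (key _ _).2]

theorem embed_monomial (v : Fin n →₀ ℕ) :
    h.embed (MvPowerSeries.monomial v 1) = monomial q (scale d v) := by
  classical
  ext s
  by_cases hs : ∃ w, scale d w = s
  · obtain ⟨w, rfl⟩ := hs
    rw [h.coeff_embed_scale, MvPowerSeries.coeff_monomial]
    simp [monomial, Pi.single_apply, h.scale_injective.eq_iff]
  · rw [h.coeff_embed_of_forall_ne _ hs]
    simp only [monomial]
    rw [Pi.single_eq_of_ne]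
    rintro rfl
    exact hs ⟨v, rfl⟩

theorem isUnit_embed_monomial (v : Fin n →₀ ℕ) :
    IsUnit (h.embed (MvPowerSeries.monomial v 1)) := by
  rw [h.embed_monomial]
  exact isUnit_monomial _

theorem coeff_embed_mul_monomial (F : MvPowerSeries (Fin n) k) (t s : Fin n → ℤ) :
    (h.embed F * monomial q t).coeff s = (h.embed F).coeff (s - t) := by
  rw [coeff_mul_monomial]
  by_cases hs : s - t ∈ qRadical q
  · rw [h.qCocycle_left hs, Units.val_one, one_mul]
  · rw [h.coeff_embed_of_notMem F hs, mul_zero]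

/-- The parametrization `(F_t) ↦ ∑ F_t(y) x^t` of the power series in `L`. -/
noncomputable def combine : (box d → MvPowerSeries (Fin n) k) →+ QLaurent q where
  toFun F := ∑ t : box d, h.embed (F t) * monomial q t
  map_zero' := by simp
  map_add' F G := by simp [add_mul, Finset.sum_add_distrib]

theorem combine_smul (a : MvPowerSeries (Fin n) k) (F : box d → MvPowerSeries (Fin n) k) :
    h.combine (a • F) = h.embed a * h.combine F := by
  simp [combine, Finset.mul_sum, mul_assoc]

theorem combine_single_zero [DecidableEq (box d)] (a : MvPowerSeries (Fin n) k) :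
    h.combine (Pi.single ⟨0, h.zero_mem_box⟩ a) = h.embed a := by
  change ∑ t : box d, _ = _
  rw [Finset.sum_eq_single ⟨0, h.zero_mem_box⟩]
  · simp [monomial_zero]
  · intro t _ ht
    simp [Pi.single_eq_of_ne ht]
  · simp

theorem part_combine (F : box d → MvPowerSeries (Fin n) k) (t : box d) :
    part (h.combine F) t = h.embed (F t) * monomial q t := by
  ext s
  rw [h.coeff_embed_mul_monomial]
  by_cases hs : s - t ∈ qRadical q
  · rw [coeff_part_of_mem hs]
    change (∑ t : box d, _ : QLaurent q).coeff s = _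
    rw [coeff_sum, Finset.sum_eq_single t]
    · rw [h.coeff_embed_mul_monomial]
    · intro t' _ hne
      rw [h.coeff_embed_mul_monomial]
      refine h.coeff_embed_of_notMem _ fun hs' => hne (Subtype.ext (h.eq_of_mem_box t'.2 t.2 ?_))
      have := sub_mem hs hs'
      rwa [sub_sub_sub_cancel_left] at this
    · simp
  · rw [coeff_part_of_notMem hs, h.coeff_embed_of_notMem _ hs]

theorem combine_injective : Function.Injective h.combine := by
  intro F G e
  funext t
  refine h.embed_injective ((isUnit_monomial (q := q) (t : Fin n → ℤ)).mul_left_injective ?_)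
  change h.embed (F t) * _ = h.embed (G t) * _
  rw [← h.part_combine, ← h.part_combine, e]

theorem exists_combine_eq {f : QLaurent q} (hf : IsPowerSeries f) : ∃ F, h.combine F = f := by
  let F : box d → MvPowerSeries (Fin n) k := fun t v => f.coeff (t + scale d v)
  have hF : ∀ t v, MvPowerSeries.coeff v (F t) = f.coeff (t + scale d v) := fun _ _ => rfl
  refine ⟨F, ?_⟩
  conv_rhs => rw [← h.sum_part f, ← Finset.sum_coe_sort]
  refine Finset.sum_congr rfl fun t _ => ?_
  ext s
  rw [h.coeff_embed_mul_monomial]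
  by_cases hs : s - t ∈ qRadical q
  · rw [coeff_part_of_mem hs]
    by_cases h0 : ∀ i, 0 ≤ (s - t) i
    · obtain ⟨v, hv⟩ := h.exists_scale_eq hs h0
      rw [← hv, h.coeff_embed_scale, hF, hv, add_sub_cancel]
    · obtain ⟨i, hi⟩ := not_forall.1 h0
      rw [not_le] at hi
      -- A negative multiple of `d i` is at most `-d i`, and `t i < d i`; hence `s i < 0` and both
      -- coefficients vanish.
      have h1 := Int.le_of_dvd (neg_pos.2 hi) ((dvd_neg).2 ((h.mem_iff _).1 hs i))
      have h2 := mem_box.1 t.2 i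
      rw [Pi.sub_apply] at h1
      rw [hf s ⟨i, by linarith⟩, h.coeff_embed_of_forall_ne]
      rintro ⟨v, hv⟩
      rw [← hv] at hi
      exact absurd hi (not_lt.2 (scale_nonneg v i))
  · rw [coeff_part_of_notMem hs, h.coeff_embed_of_notMem _ hs]

/-- Every Laurent series becomes a power series after multiplication with a central monomial. -/
theorem exists_combine_eq_monomial_mul (f : QLaurent q) :
    ∃ v F, h.combine F = h.embed (MvPowerSeries.monomial v 1) * f := by
  obtain ⟨N, hN⟩ := f.bounded
  let v : Fin n →₀ ℕ := Finsupp.equivFunOnFinite.symm fun _ => (-N).toNat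
  have hv : ∀ i, -N ≤ scale d v i := by
    intro i
    have h1 : (1 : ℤ) ≤ d i := by exact_mod_cast h.pos i
    have h2 : scale d v i = d i * ((-N).toNat : ℤ) := rfl
    rw [h2]
    nlinarith [Int.self_le_toNat (-N), Int.natCast_nonneg (-N).toNat]
  refine ⟨v, h.exists_combine_eq fun s ⟨i, hi⟩ => ?_⟩
  rw [h.embed_monomial, coeff_monomial_mul, hN, mul_zero]
  refine ⟨i, ?_⟩
  have := hv i
  rw [Pi.sub_apply]
  linarith

end IsRadicalDiagonal

/-! ### Noetherianity. -/

/-- Transfer of the ascending chain condition along a map that meets every cyclic submodule in a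
generator. -/
theorem isNoetherian_of_addMonoidHom {A M R N : Type*} [Ring A] [AddCommGroup M] [Module A M]
    [Ring R] [AddCommGroup N] [Module R N] [IsNoetherian R N] (ψ : N →+ M)
    (hψ : ∀ (r : R) (x : N), ∃ a : A, ψ (r • x) = a • ψ x)
    (hM : ∀ m : M, ∃ u v : A, v • u • m = m ∧ ∃ x, ψ x = u • m) : IsNoetherian A M := by
  let Φ : Submodule A M → Submodule R N := fun I =>
    { carrier := {x | ψ x ∈ I}
      add_mem' := fun {x y} hx hy => by
        rw [Set.mem_ofPred_eq, map_add]
        exact I.add_mem hx hy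
      zero_mem' := by simp
      smul_mem' := fun r x hx => by
        obtain ⟨a, ha⟩ := hψ r x
        rw [Set.mem_ofPred_eq, ha]
        exact I.smul_mem a hx }
  have hmem : ∀ I x, x ∈ Φ I ↔ ψ x ∈ I := fun _ _ => Iff.rfl
  -- A submodule is recovered from its preimage: `m = v • u • m`, and `u • m` lies in the range of
  -- `ψ`. Thus `Φ` is strictly monotone.
  have hmono : ∀ I J, Φ I ≤ Φ J ↔ I ≤ J := by
    refine fun I J => ⟨fun hIJ m hm => ?_, fun hIJ x hx => hIJ hx⟩
    obtain ⟨u, v, huv, x, hx⟩ := hM m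
    rw [← huv]
    refine J.smul_mem v ?_
    rw [← hx, ← hmem]
    refine hIJ ?_
    rw [hmem, hx]
    exact I.smul_mem u hm
  rw [isNoetherian_iff]
  exact (StrictMono.wellFoundedGT (f := Φ) fun I J hIJ =>
    lt_of_le_not_ge ((hmono _ _).2 hIJ.le) fun hJI => hIJ.not_ge ((hmono _ _).1 hJI)).wf

namespace IsRadicalDiagonal

open QLaurent

variable {k : Type*} [Field k] {n : ℕ} {q : Fin n → Fin n → kˣ} {d : Fin n → ℕ}
  (h : IsRadicalDiagonal q d)
include h

theorem isNoetherian_left : IsNoetherian (QLaurent q) (QLaurent q) := by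
  refine isNoetherian_of_addMonoidHom (R := MvPowerSeries (Fin n) k) h.combine
    (fun a F => ⟨h.embed a, h.combine_smul a F⟩) fun f => ?_
  obtain ⟨v, F, hF⟩ := h.exists_combine_eq_monomial_mul f
  obtain ⟨w, hw⟩ := h.isUnit_embed_monomial v
  refine ⟨w, (w⁻¹ : (QLaurent q)ˣ), ?_, F, ?_⟩
  · simp
  · rw [hF, hw, smul_eq_mul]

theorem isNoetherian_right : IsNoetherian (QLaurent q)ᵐᵒᵖ (QLaurent q) := by
  refine isNoetherian_of_addMonoidHom (R := MvPowerSeries (Fin n) k) h.combine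
    (fun a F => ⟨MulOpposite.op (h.embed a), ?_⟩) fun f => ?_
  · rw [h.combine_smul, h.embed_mul_comm, op_smul_eq_mul]
  obtain ⟨v, F, hF⟩ := h.exists_combine_eq_monomial_mul f
  obtain ⟨w, hw⟩ := h.isUnit_embed_monomial v
  refine ⟨MulOpposite.op w, MulOpposite.op (w⁻¹ : (QLaurent q)ˣ), ?_, F, ?_⟩
  · simp [mul_assoc]
  · rw [hF, h.embed_mul_comm, hw, op_smul_eq_mul]

/-! ### Prime ideals generated by central series, and height one. -/

/-- The two-sided ideal generated by a central power series. -/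
noncomputable def centralIdeal (p : MvPowerSeries (Fin n) k) : TwoSidedIdeal (QLaurent q) :=
  TwoSidedIdeal.mk' {f | ∃ g, f = h.embed p * g} ⟨0, by simp⟩
    (fun {x y} ⟨a, ha⟩ ⟨b, hb⟩ => ⟨a + b, by rw [ha, hb, mul_add]⟩)
    (fun {x} ⟨a, ha⟩ => ⟨-a, by rw [ha, mul_neg]⟩)
    (fun {x y} ⟨a, ha⟩ => ⟨x * a, by rw [ha, ← mul_assoc, ← h.embed_mul_comm, mul_assoc]⟩)
    (fun {x y} ⟨a, ha⟩ => ⟨a * y, by rw [ha, mul_assoc]⟩)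

theorem mem_centralIdeal {p : MvPowerSeries (Fin n) k} {f : QLaurent q} :
    f ∈ h.centralIdeal p ↔ ∃ g, f = h.embed p * g := by
  simp [centralIdeal, TwoSidedIdeal.mem_mk']

theorem monomial_mul_mem_iff (I : TwoSidedIdeal (QLaurent q)) (v : Fin n →₀ ℕ) (f : QLaurent q) :
    h.embed (MvPowerSeries.monomial v 1) * f ∈ I ↔ f ∈ I := by
  refine ⟨fun hf => ?_, I.mul_mem_left _ _⟩
  obtain ⟨w, hw⟩ := h.isUnit_embed_monomial v
  have := I.mul_mem_left (↑w⁻¹ : QLaurent q) _ hf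
  rwa [← hw, Units.inv_mul_cancel_left] at this

/-- The homogeneous component `F_t(y) x^t` lies in `I`, and `x^t` is a unit. -/
theorem embed_mem_of_combine_mem {I : TwoSidedIdeal (QLaurent q)}
    {F : box d → MvPowerSeries (Fin n) k} (hF : h.combine F ∈ I) (t : box d) :
    h.embed (F t) ∈ I := by
  have h1 := h.part_mem hF t.2
  rw [h.part_combine] at h1
  obtain ⟨w, hw⟩ := isUnit_monomial (q := q) (t : Fin n → ℤ)
  have := I.mul_mem_right _ (↑w⁻¹ : QLaurent q) h1
  rwa [← hw, Units.mul_inv_cancel_right] at this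

section

variable {p : MvPowerSeries (Fin n) k} (hp : (Ideal.span {p}).IsPrime)
  (hX : ∀ v, MvPowerSeries.monomial v (1 : k) ∉ Ideal.span {p})
include hp hX

/-- A quotient by `p` in `L` may have a monomial denominator. Clearing it and comparing coordinates
gives `y^v F_t ∈ (p)`, and `y^v` cancels because `(p)` is prime and contains no monomial. -/
theorem combine_mem_centralIdeal_iff (F : box d → MvPowerSeries (Fin n) k) :
    h.combine F ∈ h.centralIdeal p ↔ ∀ t, F t ∈ Ideal.span {p} := by
  constructor
  · intro hF t
    obtain ⟨g, hg⟩ := h.mem_centralIdeal.1 hF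
    obtain ⟨v, G, hG⟩ := h.exists_combine_eq_monomial_mul g
    have h1 : h.combine (MvPowerSeries.monomial v (1 : k) • F) = h.combine (p • G) := by
      rw [h.combine_smul, h.combine_smul, hG, hg, ← mul_assoc, ← mul_assoc, ← map_mul, ← map_mul,
        mul_comm p]
    have h2 := congrFun (h.combine_injective h1) t
    simp only [Pi.smul_apply, smul_eq_mul] at h2
    refine (hp.mem_or_mem (x := MvPowerSeries.monomial v (1 : k)) ?_).resolve_left (hX v)
    rw [h2]
    exact Ideal.mul_mem_right _ _ (Ideal.mem_span_singleton_self p)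
  · intro hF
    simp only [Ideal.mem_span_singleton] at hF
    choose G hG using hF
    refine h.mem_centralIdeal.2 ⟨h.combine G, ?_⟩
    rw [← h.combine_smul]
    congr 1
    funext t
    exact hG t

theorem embed_mem_centralIdeal_iff (F : MvPowerSeries (Fin n) k) :
    h.embed F ∈ h.centralIdeal p ↔ F ∈ Ideal.span {p} := by
  classical
  rw [← h.combine_single_zero, h.combine_mem_centralIdeal_iff hp hX]
  refine ⟨fun H => by simpa using H ⟨0, h.zero_mem_box⟩, fun hF t => ?_⟩
  by_cases ht : t = ⟨0, h.zero_mem_box⟩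
  · subst ht
    simpa using hF
  · rw [Pi.single_eq_of_ne ht]
    exact zero_mem _

/-- Some coordinate of `f`, after clearing denominators, lies outside `(p)`. This replaces arbitrary
elements by central ones when testing primality. -/
theorem exists_notMem_of_notMem_centralIdeal {f : QLaurent q} (hf : f ∉ h.centralIdeal p) :
    ∃ F ∉ Ideal.span {p}, ∀ I : TwoSidedIdeal (QLaurent q), f ∈ I → h.embed F ∈ I := by
  obtain ⟨v, F, hF⟩ := h.exists_combine_eq_monomial_mul f
  rw [← h.monomial_mul_mem_iff _ v, ← hF, h.combine_mem_centralIdeal_iff hp hX] at hf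
  obtain ⟨t, ht⟩ := not_forall.1 hf
  refine ⟨F t, ht, fun I hI => h.embed_mem_of_combine_mem ?_ t⟩
  rw [hF]
  exact I.mul_mem_left _ _ hI

theorem isPrimeTwoSided_centralIdeal : IsPrimeTwoSided (h.centralIdeal p) := by
  constructor
  · intro htop
    have h1 : h.embed 1 ∈ h.centralIdeal p := by rw [htop]; trivial
    rw [h.embed_mem_centralIdeal_iff hp hX] at h1
    exact hp.ne_top ((Ideal.eq_top_iff_one _).2 h1)
  · intro a b hab
    by_contra! hn
    obtain ⟨F, hF, hFI⟩ := h.exists_notMem_of_notMem_centralIdeal hp hX hn.1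
    obtain ⟨G, hG, hGI⟩ := h.exists_notMem_of_notMem_centralIdeal hp hX hn.2
    set Q := h.centralIdeal p
    -- The elements `f` with `f L b ⊆ Q` form a two-sided ideal containing `a`, hence containing the
    -- central `F`.
    let I : TwoSidedIdeal (QLaurent q) := TwoSidedIdeal.mk' {f | ∀ r, f * r * b ∈ Q}
      (fun r => by simp [Q.zero_mem])
      (fun {x y} hx hy r => by rw [add_mul, add_mul]; exact Q.add_mem (hx r) (hy r))
      (fun {x} hx r => by rw [neg_mul, neg_mul]; exact Q.neg_mem (hx r))
      (fun {x y} hy r => by rw [mul_assoc, mul_assoc, ← mul_assoc y]; exact Q.mul_mem_left _ _ (hy r))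
      (fun {x y} hx r => by rw [mul_assoc x]; exact hx _)
    have hI : ∀ f, f ∈ I ↔ ∀ r, f * r * b ∈ Q := fun f => by simp [I, TwoSidedIdeal.mem_mk']
    have h1 := (hI _).1 (hFI I ((hI _).2 hab))
    have h2 : h.embed F * b ∈ Q := by simpa using h1 1
    -- Since `F` is central, this is a two-sided ideal. It contains `b`, hence `G`, so that `F * G ∈
    -- (p)`.
    let J : TwoSidedIdeal (QLaurent q) := TwoSidedIdeal.mk' {f | h.embed F * f ∈ Q}
      (by simp [Q.zero_mem])
      (fun {x y} hx hy => by rw [Set.mem_ofPred_eq, mul_add]; exact Q.add_mem hx hy)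
      (fun {x} hx => by rw [Set.mem_ofPred_eq, mul_neg]; exact Q.neg_mem hx)
      (fun {x y} hy => by
        rw [Set.mem_ofPred_eq, ← mul_assoc, h.embed_mul_comm, mul_assoc]
        exact Q.mul_mem_left _ _ hy)
      (fun {x y} hx => by rw [Set.mem_ofPred_eq, ← mul_assoc]; exact Q.mul_mem_right _ _ hx)
    have hJ : ∀ f, f ∈ J ↔ h.embed F * f ∈ Q := fun f => by simp [J, TwoSidedIdeal.mem_mk']
    have h3 := (hJ _).1 (hGI J ((hJ _).2 h2))
    rw [← map_mul, h.embed_mem_centralIdeal_iff hp hX] at h3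
    exact (hp.mem_or_mem h3).elim hF hG

end

theorem isPrimeRing : IsPrimeRing (QLaurent q) := by
  have : IsDomain (MvPowerSeries (Fin n) k) := NoZeroDivisors.to_isDomain _
  have h1 : (Ideal.span {(0 : MvPowerSeries (Fin n) k)}).IsPrime := by
    rw [Ideal.span_singleton_eq_bot.2 rfl]
    exact Ideal.isPrime_bot
  have h2 : h.centralIdeal 0 = ⊥ := by
    ext f
    rw [h.mem_centralIdeal, TwoSidedIdeal.mem_bot]
    simp
  rw [IsPrimeRing, ← h2]
  refine h.isPrimeTwoSided_centralIdeal h1 fun v hv => ?_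
  rw [Ideal.span_singleton_eq_bot.2 rfl, Ideal.mem_bot] at hv
  have := congrArg (MvPowerSeries.coeff v) hv
  simp at this

/-- The contraction of `P` to `k[[y]]` is prime by centrality and nonzero by the grading, so
factoriality yields a prime element `p` in it. Monomials are units of `L`, so `(p)` contains none of
them. -/
theorem exists_prime_centralIdeal_le [Infinite k] {P : TwoSidedIdeal (QLaurent q)}
    (hP : IsPrimeTwoSided P) (h0 : P ≠ ⊥) : ∃ p : MvPowerSeries (Fin n) k,
      h.centralIdeal p ≤ P ∧ h.centralIdeal p ≠ ⊥ ∧ IsPrimeTwoSided (h.centralIdeal p) := by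
  have : IsDomain (MvPowerSeries (Fin n) k) := NoZeroDivisors.to_isDomain _
  have : UniqueFactorizationMonoid (MvPowerSeries (Fin n) k) :=
    MvPowerSeries.uniqueFactorizationMonoid_fin n
  have hunit : ∀ x ∈ P, ¬ IsUnit x := by
    rintro _ hx ⟨u, rfl⟩
    refine hP.1 (eq_top_iff.2 fun y _ => ?_)
    have := P.mul_mem_right _ ((↑u⁻¹ : QLaurent q) * y) hx
    rwa [Units.mul_inv_cancel_left] at this
  let 𝔭 : Ideal (MvPowerSeries (Fin n) k) :=
    { carrier := {F | h.embed F ∈ P}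
      add_mem' := fun {F G} hF hG => by
        rw [Set.mem_ofPred_eq, map_add]
        exact P.add_mem hF hG
      zero_mem' := by simp [P.zero_mem]
      smul_mem' := fun a F hF => by
        rw [Set.mem_ofPred_eq, smul_eq_mul, map_mul]
        exact P.mul_mem_left _ _ hF }
  have hmem : ∀ F, F ∈ 𝔭 ↔ h.embed F ∈ P := fun _ => Iff.rfl
  have hprime : 𝔭.IsPrime := by
    refine ⟨fun htop => ?_, fun {F G} hFG => hP.2 _ _ fun r => ?_⟩
    · have h1 := (hmem 1).1 (htop ▸ trivial)
      exact hunit _ h1 (by rw [map_one]; exact isUnit_one)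
    · rw [mul_assoc, ← h.embed_mul_comm, ← mul_assoc, ← map_mul, h.embed_mul_comm]
      exact P.mul_mem_left _ _ hFG
  have hne : 𝔭 ≠ ⊥ := by
    intro hbot
    refine h0 (eq_bot_iff.2 fun f hf => ?_)
    obtain ⟨v, F, hF⟩ := h.exists_combine_eq_monomial_mul f
    rw [← h.monomial_mul_mem_iff, ← hF] at hf
    have hF0 : F = 0 := by
      funext t
      have h1 := (hmem _).2 (h.embed_mem_of_combine_mem hf t)
      rwa [hbot, Ideal.mem_bot] at h1
    rw [← h.monomial_mul_mem_iff _ v, ← hF, hF0, map_zero]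
    exact TwoSidedIdeal.zero_mem _
  obtain ⟨p, hp𝔭, hp⟩ := hprime.exists_mem_prime_of_ne_bot hne
  have hspan : Ideal.span {p} ≤ 𝔭 := (Ideal.span_singleton_le_iff_mem _).2 hp𝔭
  refine ⟨p, fun f hf => ?_, fun hbot => ?_, h.isPrimeTwoSided_centralIdeal
    ((Ideal.span_singleton_prime hp.ne_zero).2 hp)
    fun v hv => hunit _ ((hmem _).1 (hspan hv)) (h.isUnit_embed_monomial v)⟩
  · obtain ⟨g, rfl⟩ := h.mem_centralIdeal.1 hf
    exact P.mul_mem_right _ _ hp𝔭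
  · have h1 : h.embed p ∈ h.centralIdeal p := h.mem_centralIdeal.2 ⟨1, (mul_one _).symm⟩
    rw [hbot, TwoSidedIdeal.mem_bot] at h1
    exact hp.ne_zero (h.embed_injective (h1.trans (map_zero _).symm))

theorem isPrincipalTwoSided_of_isHeightOnePrime [Infinite k] {P : TwoSidedIdeal (QLaurent q)}
    (hP : IsHeightOnePrime P) : IsPrincipalTwoSided P := by
  obtain ⟨hprime, hheight⟩ := hP
  have h0 : P ≠ ⊥ := by
    rintro rfl
    have h1 : IsMin (⟨⊥, hprime⟩ : {Q : TwoSidedIdeal (QLaurent q) // IsPrimeTwoSided Q}) :=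
      fun Q _ => bot_le (a := Q.1)
    rw [Order.height_eq_zero.2 h1] at hheight
    exact zero_ne_one hheight
  obtain ⟨p, hle, hne, hQ⟩ := h.exists_prime_centralIdeal_le hprime h0
  -- Otherwise `0 < pL < P` would be a chain of primes of length two.
  have hPQ : P = h.centralIdeal p := by
    by_contra hneq
    let Z : {Q : TwoSidedIdeal (QLaurent q) // IsPrimeTwoSided Q} := ⟨⊥, h.isPrimeRing⟩
    let Q : {Q : TwoSidedIdeal (QLaurent q) // IsPrimeTwoSided Q} := ⟨h.centralIdeal p, hQ⟩
    let P' : {Q : TwoSidedIdeal (QLaurent q) // IsPrimeTwoSided Q} := ⟨P, hprime⟩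
    have h1 : Z < Q := (bot_lt_iff_ne_bot.2 hne : (⊥ : TwoSidedIdeal (QLaurent q)) < _)
    have h2 : Q < P' := (lt_of_le_of_ne hle (Ne.symm hneq) : h.centralIdeal p < P)
    have h3 := Order.height_add_one_le h1
    have h4 := Order.height_add_one_le h2
    rw [show Order.height P' = 1 from hheight] at h4
    have h5 := (add_le_add_left ((le_add_of_nonneg_left bot_le).trans h3) 1).trans h4
    exact absurd h5 (by norm_num)
  refine ⟨h.embed p, fun x => ?_, fun x => ?_⟩
  · rw [hPQ, h.mem_centralIdeal]
  · rw [hPQ, h.mem_centralIdeal]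
    simp only [h.embed_mul_comm]

end IsRadicalDiagonal

theorem proposition4p1 {k : Type*} [Field k] [IsAlgClosed k] {n : ℕ} (hn : 0 < n)
    (q : Fin n → Fin n → kˣ) (hq_diag : ∀ i, q i i = 1) (hq_anti : ∀ i j, q i j = (q j i)⁻¹)
    (hq_root : ∀ i j, ∃ m : ℕ, 0 < m ∧ q i j ^ m = 1)
    (hS : HasPositiveDiagonalBasis (qRadical q)) :
    IsUniqueFactorizationRing (QLaurent q) := by
  obtain ⟨d, h⟩ := exists_isRadicalDiagonal hq_diag hq_anti hS
  have : Infinite k := IsAlgClosed.instInfinite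
  exact ⟨h.isNoetherian_left, h.isNoetherian_right, h.isPrimeRing,
    fun P hP => h.isPrincipalTwoSided_of_isHeightOnePrime hP⟩
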